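/- For $r\ge 0$ let $\mathrm{vol}_r$ be the $r$-dimensional Hausdorff measure on $\mathbb{R}^{p}$, normalised so that for integer $r$ it agrees with Lebesgue measure on $r$-dimensional affine subspaces. For $K\subseteq\mathbb{R}^p$ of Hausdorff dimension $q$, define the Oertel radius $$\mathcal{F}(K)=\sup_{x\in K}\ \inf_{u\in\mathbb{R}^p\setminus\{0\}}\ \frac{\mathrm{vol}_q(\{y\in K: u^{\top}(y-x)\ge 0\})}{\mathrm{vol}_q(K)}.$$ Theorem. (1) There is a universal constant $A>0$ such that the following holds for all integers $d\ge 1$ and $k\ge 1$. Let $C\subset\mathbb{R}\times\mathbb{R}^{d}$ be a convex body (a compact convex set with nonempty interior), let $S=C\cap(\mathbb{Z}\times\mathbb{R}^d)$, and suppose that the projection of $S$ onto the first coordinate is $\{0,1,\dots,k\}$. Then there is a point $\bar{\mathbf{x}}\in S$ such that every halfspace $H\subset\mathbb{R}^{d+1}$ containing $\bar{\mathbf{x}}$ satisfies $$\mathrm{vol}_d(S\cap H)\ \ge\ \Big(\frac1e-A\,\frac{d}{k}\Big)\,\mathrm{vol}_d(S).$$ (2) There is a universal constant $\alpha>0$ such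 that for all integers $d\ge 1$ and $k\ge\alpha d$ and all $C$, $S$ as in (1), $$\mathcal{F}(S)\ \ge\ \frac12\Big(\frac{d}{d+1}\Big)^{d}.$$ -/

import Mathlib

/-- The `r`-dimensional Hausdorff measure on `ℝᵖ` with its classical normalisation
`π^(r/2) / (Γ(r/2 + 1) 2^r)`, the one for which it agrees with the `r`-dimensional Lebesgue measure
on `r`-dimensional affine subspaces when `r` is an integer. (Mathlib's `hausdorffMeasure r` is built
from the sums of `diam ^ r` without that constant.) -/
noncomputable def hausdorffVol {p : ℕ} (r : ℝ) :
    MeasureTheory.Measure (EuclideanSpace ℝ (Fin p)) :=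
  ENNReal.ofReal (Real.pi ^ (r / 2) / (Real.Gamma (r / 2 + 1) * 2 ^ r)) •
    MeasureTheory.Measure.hausdorffMeasure r

/-- The halfspace `H(u, x) = {y : uᵀ(y - x) ≥ 0}`, with `x` on its boundary. -/
def halfspaceAt {p : ℕ} (u x : EuclideanSpace ℝ (Fin p)) : Set (EuclideanSpace ℝ (Fin p)) :=
  {y | 0 ≤ inner ℝ u (y - x)}

/-- `H` is a (closed, affine) halfspace of `ℝᵖ`. -/
def IsHalfspace {p : ℕ} (H : Set (EuclideanSpace ℝ (Fin p))) : Prop :=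
  ∃ u : EuclideanSpace ℝ (Fin p), u ≠ 0 ∧ ∃ b : ℝ, H = {y | b ≤ inner ℝ u y}

/-- The Oertel radius of `K ⊆ ℝᵖ`: the supremum over `x ∈ K` of the infimum over `u ≠ 0` of
`vol_q (H(u, x) ∩ K) / vol_q K`, where `q` is the Hausdorff dimension of `K`. -/
noncomputable def oertelRadius {p : ℕ} (K : Set (EuclideanSpace ℝ (Fin p))) : ENNReal :=
  ⨆ x ∈ K, ⨅ u : EuclideanSpace ℝ (Fin p), ⨅ _ : u ≠ 0,
    hausdorffVol (dimH K).toReal (halfspaceAt u x ∩ K) / hausdorffVol (dimH K).toReal K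

/-- The mixed-integer set `C ∩ (ℤ × ℝᵈ)`; coordinate `0` of `ℝᵈ⁺¹` is the integer one. -/
def mixedIntegerPart {d : ℕ} (C : Set (EuclideanSpace ℝ (Fin (d + 1)))) :
    Set (EuclideanSpace ℝ (Fin (d + 1))) :=
  {x | x ∈ C ∧ ∃ z : ℤ, x 0 = (z : ℝ)}

/-- The set of integers that occur as the first coordinate of a point of `S`. -/
def integerProjection {d : ℕ} (S : Set (EuclideanSpace ℝ (Fin (d + 1)))) : Set ℤ :=
  {z | ∃ x ∈ S, x 0 = (z : ℝ)}

/-!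
Identify `ℝᵈ⁺¹` with `ℝ × F`, `F = ℝᵈ`, so that the mixed-integer set is the union of the sections
of the convex body `D ⊆ ℝ × F` over the integers, and its `d`-dimensional measure is the sum of the
volumes of these sections. The proof compares this sum with the `(d + 1)`-dimensional volume of `D`,
for which Grünbaum's inequality holds.

* The Brunn–Minkowski inequality, in the multiplicative form
  `measure_rpow_mul_rpow_le_of_combination_mem`, comes from the Prékopa–Leindler inequality.
* It makes the volume of `D ∩ {L ≤ t}` a log-concave function of `t`. With `p` the normalised
  volume, Jensen's inequality gives `log p(E X) ≥ E log p(X)` for the value `X` of `L` at a random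
  point of `D`, and `E log p(X) ≥ -1` because `p(X)` is at least uniformly distributed. So every
  halfspace at the centroid has at least `1/e` of the volume
  (`measure_le_exp_one_mul_measure_inter_centroid_le`).
* The centroid need not have an integer first coordinate. Moving it towards a point of `D` over `0`
  or over `k` by a fraction `s ≤ 2 / k` makes that coordinate an integer, and costs at most a factor
  `(1 - s) ^ (d + 1) = 1 - O(d / k)`, by a homothety centred at the point of `D`
  (`pow_mul_measure_le_measure_inter_halfspace`).
* By Brunn–Minkowski again, the section volumes of `D`, and of `D` cut by a halfspace, are
  quasiconcave in the first coordinate. The sum of such a function over the integers differs from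
  its integral by at most its maximum, since an interval and the number of its integers differ by at
  most `1` on each superlevel set.
* The maximal section volume is itself only `O(d / k)` times the volume of `D`
  (`sectionVolume_le`): shrinking a section towards a point over `0` or `k` shows that the sections
  over an interval of length of order `k / d` are at least half as large.

Together these give the constant `1/e - 20 d / k`. The bound on the Oertel radius follows, because
`(d / (d + 1)) ^ d / 2 ≤ 1 / 4 < 1 / e`; positivity and finiteness of the `d`-dimensional Hausdorff
measure show that the mixed-integer set has Hausdorff dimension `d`.
-/

open MeasureTheory Set
open scoped ENNReal Pointwise

/-! ### The Prékopa–Leindler inequality -/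

/-- The weighted inequality of arithmetic and geometric means on `[0, ∞]`. -/
theorem ENNReal.rpow_mul_rpow_le_add {a b : ℝ} (ha : 0 < a) (hb : 0 < b) (hab : a + b = 1)
    (x y : ℝ≥0∞) : x ^ a * y ^ b ≤ ENNReal.ofReal a * x + ENNReal.ofReal b * y := by
  have ha' : ENNReal.ofReal a ≠ 0 := by simpa using ha
  have hb' : ENNReal.ofReal b ≠ 0 := by simpa using hb
  rcases eq_or_ne x ⊤ with rfl | hx
  · simp [ENNReal.mul_top ha']
  rcases eq_or_ne y ⊤ with rfl | hy
  · simp [ENNReal.mul_top hb']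
  have hx' := ENNReal.rpow_ne_top_of_nonneg ha.le hx
  have hy' := ENNReal.rpow_ne_top_of_nonneg hb.le hy
  rw [← ENNReal.toReal_le_toReal (ENNReal.mul_ne_top hx' hy') (by finiteness),
    ENNReal.toReal_add (by finiteness) (by finiteness), ENNReal.toReal_mul, ENNReal.toReal_mul,
    ENNReal.toReal_mul, ENNReal.toReal_ofReal ha.le, ENNReal.toReal_ofReal hb.le,
    ← ENNReal.toReal_rpow, ← ENNReal.toReal_rpow]
  exact Real.geom_mean_le_arith_mean2_weighted ha.le hb.le ENNReal.toReal_nonneg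
    ENNReal.toReal_nonneg hab

/-- The affine image `a • K + c` of a set of reals has length `a` times that of `K`. -/
theorem Real.volume_image_mul_add {a : ℝ} (ha : 0 ≤ a) (c : ℝ) (K : Set ℝ) :
    volume ((fun x => a * x + c) '' K) = ENNReal.ofReal a * volume K := by
  have h : (fun x => a * x + c) '' K = (fun x => x + c) '' (a • K) := by
    rw [← Set.image_smul, Set.image_image]; rfl
  rw [h, Set.image_add_right, measure_preimage_add_right, Measure.addHaar_smul]
  simp [abs_of_nonneg ha]

/-- The one-dimensional Brunn–Minkowski inequality. For compact `K` and `L`, the translates of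
`a • K` and `b • L` through `a * max K + b * min L` lie in the Minkowski combination and share only
that point. -/
theorem Real.volume_add_volume_le_of_combination_mem {a b : ℝ} (ha : 0 ≤ a) (hb : 0 ≤ b)
    {A B M : Set ℝ} (hA : MeasurableSet A) (hB : MeasurableSet B) (hA' : A.Nonempty)
    (hB' : B.Nonempty) (h : ∀ x ∈ A, ∀ y ∈ B, a * x + b * y ∈ M) :
    ENNReal.ofReal a * volume A + ENNReal.ofReal b * volume B ≤ volume M := by
  have key : ∀ K L : Set ℝ, K ⊆ A → IsCompact K → K.Nonempty → L ⊆ B → IsCompact L → L.Nonempty →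
      ENNReal.ofReal a * volume K + ENNReal.ofReal b * volume L ≤ volume M := by
    intro K L hKA hK hK' hLB hL hL'
    obtain ⟨x₀, hx₀, hx₀'⟩ := hK.exists_isGreatest hK'
    obtain ⟨y₀, hy₀, hy₀'⟩ := hL.exists_isLeast hL'
    rw [← Real.volume_image_mul_add ha (b * y₀) K, ← Real.volume_image_mul_add hb (a * x₀) L,
      ← measure_union₀]
    · refine measure_mono ?_
      rintro _ (⟨x, hx, rfl⟩ | ⟨y, hy, rfl⟩)
      · exact h x (hKA hx) y₀ (hLB hy₀)
      · have := h x₀ (hKA hx₀) y (hLB hy)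
        rwa [add_comm] at this
    · exact (hL.image (by fun_prop)).measurableSet.nullMeasurableSet
    · refine measure_mono_null (t := {a * x₀ + b * y₀}) ?_ (by simp)
      rintro z ⟨⟨x, hx, rfl⟩, ⟨y, hy, hxy⟩⟩
      have h1 := mul_le_mul_of_nonneg_left (hx₀' hx) ha
      have h2 := mul_le_mul_of_nonneg_left (hy₀' hy) hb
      simp only [mem_singleton_iff] at hxy ⊢
      linarith
  obtain ⟨x₁, hx₁⟩ := hA'
  obtain ⟨y₁, hy₁⟩ := hB'
  rw [hA.measure_eq_iSup_isCompact, hB.measure_eq_iSup_isCompact]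
  simp only [ENNReal.mul_iSup, iSup_and']
  refine ENNReal.iSup_add_iSup_le fun K L => ?_
  by_cases hK : K ⊆ A ∧ IsCompact K
  · by_cases hL : L ⊆ B ∧ IsCompact L
    · simp only [hK, hL, and_self, iSup_pos]
      refine le_trans ?_ (key (insert x₁ K) (insert y₁ L) (insert_subset hx₁ hK.1)
        (hK.2.insert _) (insert_nonempty _ _) (insert_subset hy₁ hL.1) (hL.2.insert _)
        (insert_nonempty _ _))
      gcongr <;> exact subset_insert _ _
    · simp only [hK, hL, and_self, iSup_pos, iSup_false, bot_eq_zero, add_zero]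
      refine le_trans ?_ (key (insert x₁ K) {y₁} (insert_subset hx₁ hK.1)
        (hK.2.insert _) (insert_nonempty _ _) (by simpa using hy₁) isCompact_singleton
        (singleton_nonempty _))
      refine le_trans ?_ le_self_add
      gcongr
      exact subset_insert _ _
  · by_cases hL : L ⊆ B ∧ IsCompact L
    · simp only [hK, hL, and_self, iSup_pos, iSup_false, bot_eq_zero, zero_add]
      refine le_trans ?_ (key {x₁} (insert y₁ L) (by simpa using hx₁) isCompact_singleton
        (singleton_nonempty _) (insert_subset hy₁ hL.1) (hL.2.insert _) (insert_nonempty _ _))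
      refine le_trans ?_ le_add_self
      gcongr
      exact subset_insert _ _
    · simp [hK, hL]

/-- Layer-cake formula for a finite `[0, ∞]`-valued function. -/
theorem lintegral_eq_lintegral_measure_ofReal_lt {α : Type*} [MeasurableSpace α] (μ : Measure α)
    {f : α → ℝ≥0∞} (hf : Measurable f) (hf' : ∀ x, f x ≠ ⊤) :
    ∫⁻ x, f x ∂μ = ∫⁻ t in Ioi (0 : ℝ), μ {x | ENNReal.ofReal t < f x} := by
  have h := lintegral_eq_lintegral_meas_lt (f := fun x => (f x).toReal) μ
    (Filter.Eventually.of_forall fun _ => ENNReal.toReal_nonneg) hf.ennreal_toReal.aemeasurable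
  simp only [ENNReal.ofReal_toReal (hf' _)] at h
  rw [h]
  refine setLIntegral_congr_fun measurableSet_Ioi fun t ht => ?_
  simp only [ENNReal.ofReal_lt_iff_lt_toReal (le_of_lt ht) (hf' _)]

section PrekopaLeindlerReal

variable {a b : ℝ} (ha : 0 < a) (hb : 0 < b) (hab : a + b = 1) {f g h : ℝ → ℝ≥0∞}
  (hf : Measurable f) (hg : Measurable g) (hh : Measurable h)
  (H : ∀ x y, f x ^ a * g y ^ b ≤ h (a * x + b * y))

include ha hb hab hf hg hh H

/-- The one-dimensional Prékopa–Leindler inequality for functions of supremum `1`: here the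
superlevel sets at each height below `1` are nonempty, and the one-dimensional Brunn–Minkowski
inequality applies to them. -/
theorem lintegral_rpow_mul_rpow_le_of_iSup_eq_one (hf1 : ⨆ x, f x = 1) (hg1 : ⨆ x, g x = 1) :
    (∫⁻ x, f x) ^ a * (∫⁻ x, g x) ^ b ≤ ∫⁻ x, h x := by
  have hfle : ∀ x, f x ≤ 1 := fun x => hf1 ▸ le_iSup f x
  have hgle : ∀ x, g x ≤ 1 := fun x => hg1 ▸ le_iSup g x
  refine (ENNReal.rpow_mul_rpow_le_add ha hb hab _ _).trans ?_
  refine le_trans ?_ (lintegral_mono (fun x => min_le_left (h x) 1))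
  have hm : Measurable fun x => min (h x) 1 := hh.min measurable_const
  rw [lintegral_eq_lintegral_measure_ofReal_lt _ hf (fun x => ((hfle x).trans_lt (by simp)).ne),
    lintegral_eq_lintegral_measure_ofReal_lt _ hg (fun x => ((hgle x).trans_lt (by simp)).ne),
    lintegral_eq_lintegral_measure_ofReal_lt _ hm
      (fun x => ((min_le_right (h x) 1).trans_lt (by simp)).ne),
    ← lintegral_const_mul' _ _ (by finiteness), ← lintegral_const_mul' _ _ (by finiteness)]
  refine (le_lintegral_add _ _).trans (lintegral_mono fun t => ?_)
  rcases lt_or_ge (ENNReal.ofReal t) 1 with ht | ht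
  · obtain ⟨x₀, hx₀⟩ := lt_iSup_iff.1 (hf1 ▸ ht)
    obtain ⟨y₀, hy₀⟩ := lt_iSup_iff.1 (hg1 ▸ ht)
    refine Real.volume_add_volume_le_of_combination_mem ha.le hb.le
      (measurableSet_lt measurable_const hf) (measurableSet_lt measurable_const hg)
      ⟨x₀, hx₀⟩ ⟨y₀, hy₀⟩ fun x hx y hy => lt_min (lt_of_lt_of_le ?_ (H x y)) ht
    calc ENNReal.ofReal t = ENNReal.ofReal t ^ a * ENNReal.ofReal t ^ b := by
          rw [← ENNReal.rpow_add_of_nonneg _ _ ha.le hb.le, hab, ENNReal.rpow_one]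
      _ < f x ^ a * g y ^ b :=
          ENNReal.mul_lt_mul (ENNReal.rpow_lt_rpow hx ha) (ENNReal.rpow_lt_rpow hy hb)
  · have h1 : {x | ENNReal.ofReal t < f x} = ∅ :=
      eq_empty_of_forall_notMem fun x hx => (((hfle x).trans ht).trans_lt hx).false
    have h2 : {x | ENNReal.ofReal t < g x} = ∅ :=
      eq_empty_of_forall_notMem fun x hx => (((hgle x).trans ht).trans_lt hx).false
    simp [h1, h2]

theorem lintegral_rpow_mul_rpow_le_of_iSup_ne_top (hf1 : ⨆ x, f x ≠ ⊤) (hg1 : ⨆ x, g x ≠ ⊤) :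
    (∫⁻ x, f x) ^ a * (∫⁻ x, g x) ^ b ≤ ∫⁻ x, h x := by
  set S := ⨆ x, f x with hS
  set T := ⨆ x, g x with hT
  rcases eq_or_ne S 0 with hS0 | hS0
  · have : ∀ x, f x = 0 := by simpa [hS] using hS0
    simp [this, ha]
  rcases eq_or_ne T 0 with hT0 | hT0
  · have : ∀ x, g x = 0 := by simpa [hT] using hT0
    simp [this, hb]
  have hSa : S ^ a ≠ 0 := by simp [hS0, hf1]
  have hSa' : S ^ a ≠ ⊤ := ENNReal.rpow_ne_top_of_nonneg ha.le hf1
  have hTb : T ^ b ≠ 0 := by simp [hT0, hg1]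
  have hTb' : T ^ b ≠ ⊤ := ENNReal.rpow_ne_top_of_nonneg hb.le hg1
  have key := lintegral_rpow_mul_rpow_le_of_iSup_eq_one (f := fun x => S⁻¹ * f x)
    (g := fun x => T⁻¹ * g x) (h := fun x => (S ^ a)⁻¹ * (T ^ b)⁻¹ * h x) ha hb hab
    (hf.const_mul _) (hg.const_mul _) (hh.const_mul _) ?_
    (by rw [← ENNReal.mul_iSup, ← hS, ENNReal.inv_mul_cancel hS0 hf1])
    (by rw [← ENNReal.mul_iSup, ← hT, ENNReal.inv_mul_cancel hT0 hg1])
  · rw [lintegral_const_mul _ hf, lintegral_const_mul _ hg, lintegral_const_mul _ hh,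
      ENNReal.mul_rpow_of_nonneg _ _ ha.le, ENNReal.mul_rpow_of_nonneg _ _ hb.le,
      ENNReal.inv_rpow, ENNReal.inv_rpow, mul_mul_mul_comm] at key
    rwa [ENNReal.mul_le_mul_iff_right] at key
    · simp [hSa', hTb']
    · simp [ENNReal.mul_eq_top, hSa, hTb]
  · intro x y
    rw [ENNReal.mul_rpow_of_nonneg _ _ ha.le, ENNReal.mul_rpow_of_nonneg _ _ hb.le,
      ENNReal.inv_rpow, ENNReal.inv_rpow, mul_mul_mul_comm]
    gcongr
    exact H x y

/-- The one-dimensional Prékopa–Leindler inequality. -/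
theorem lintegral_rpow_mul_rpow_le_real :
    (∫⁻ x, f x) ^ a * (∫⁻ x, g x) ^ b ≤ ∫⁻ x, h x := by
  have trunc : ∀ u : ℝ → ℝ≥0∞, Measurable u → ∫⁻ x, u x = ⨆ n : ℕ, ∫⁻ x, min (u x) n := by
    intro u hu
    rw [← lintegral_iSup (fun n => hu.min measurable_const)]
    · refine lintegral_congr fun x => ?_
      rw [← inf_iSup_eq, ENNReal.iSup_natCast, inf_top_eq]
    · intro m n hmn x
      exact min_le_min le_rfl (by exact_mod_cast hmn)
  rw [trunc f hf, trunc g hg]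
  have e1 := (ENNReal.orderIsoRpow a ha).map_iSup fun n : ℕ => ∫⁻ x, min (f x) n
  have e2 := (ENNReal.orderIsoRpow b hb).map_iSup fun n : ℕ => ∫⁻ x, min (g x) n
  simp only [ENNReal.orderIsoRpow_apply] at e1 e2
  rw [e1, e2, ENNReal.iSup_mul]
  refine iSup_le fun m => ?_
  rw [ENNReal.mul_iSup]
  refine iSup_le fun n => lintegral_rpow_mul_rpow_le_of_iSup_ne_top ha hb hab
    (hf.min measurable_const) (hg.min measurable_const) hh ?_ ?_ ?_
  · intro x y
    refine le_trans ?_ (H x y)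
    gcongr <;> exact min_le_left _ _
  · exact ne_top_of_le_ne_top (ENNReal.natCast_ne_top m) (iSup_le fun x => min_le_right _ _)
  · exact ne_top_of_le_ne_top (ENNReal.natCast_ne_top n) (iSup_le fun x => min_le_right _ _)

end PrekopaLeindlerReal

/-- The Prékopa–Leindler inequality on `ℝⁿ`, by induction on `n`: the marginals on the first
coordinate satisfy the hypothesis of the one-dimensional inequality. -/
theorem lintegral_rpow_mul_rpow_le {a b : ℝ} (ha : 0 < a) (hb : 0 < b) (hab : a + b = 1) {n : ℕ}
    {f g h : (Fin n → ℝ) → ℝ≥0∞} (hf : Measurable f) (hg : Measurable g) (hh : Measurable h)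
    (H : ∀ x y, f x ^ a * g y ^ b ≤ h (a • x + b • y)) :
    (∫⁻ x, f x) ^ a * (∫⁻ x, g x) ^ b ≤ ∫⁻ x, h x := by
  induction n with
  | zero =>
    have h0 := H default default
    rw [Subsingleton.elim (a • default + b • default : Fin 0 → ℝ) default] at h0
    have e : ∀ u : (Fin 0 → ℝ) → ℝ≥0∞, ∫⁻ x, u x = u default := fun u => by
      rw [volume_pi, Measure.pi_of_empty (fun _ => volume) default, lintegral_dirac]
    rwa [e, e, e]
  | succ n ih =>
    have hc : Measurable fun p : ℝ × (Fin n → ℝ) => (Fin.cons p.1 p.2 : Fin (n + 1) → ℝ) :=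
      measurable_pi_lambda _ fun i => Fin.cases measurable_fst
        (fun j => (measurable_pi_apply j).comp measurable_snd) i
    have fubini : ∀ u : (Fin (n + 1) → ℝ) → ℝ≥0∞, Measurable u →
        ∫⁻ x, u x = ∫⁻ s : ℝ, ∫⁻ y : Fin n → ℝ, u (Fin.cons s y) := by
      intro u hu
      have e := (volume_preserving_piFinSuccAbove (fun _ : Fin (n + 1) => ℝ) 0).symm
      rw [← e.lintegral_comp hu, Measure.volume_eq_prod,
        lintegral_prod (fun p => u ((MeasurableEquiv.piFinSuccAbove (fun _ => ℝ) 0).symm p))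
          (hu.comp (MeasurableEquiv.measurable _)).aemeasurable]
      simp [MeasurableEquiv.piFinSuccAbove, Fin.insertNthEquiv]
    rw [fubini f hf, fubini g hg, fubini h hh]
    refine lintegral_rpow_mul_rpow_le_real ha hb hab (hf.comp hc).lintegral_prod_right'
      (hg.comp hc).lintegral_prod_right' (hh.comp hc).lintegral_prod_right' fun s t => ?_
    refine ih (hf.comp (hc.comp measurable_prodMk_left)) (hg.comp (hc.comp measurable_prodMk_left))
      (hh.comp (hc.comp measurable_prodMk_left)) fun x y => (H _ _).trans (le_of_eq ?_)
    congr 1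
    funext i
    refine Fin.cases ?_ (fun j => ?_) i <;> simp

/-- The multiplicative Brunn–Minkowski inequality for a Haar measure on a finite-dimensional
space. -/
theorem measure_rpow_mul_rpow_le_of_combination_mem {E : Type*} [NormedAddCommGroup E]
    [NormedSpace ℝ E] [FiniteDimensional ℝ E] [MeasurableSpace E] [BorelSpace E] (μ : Measure E)
    [μ.IsAddHaarMeasure] {a b : ℝ} (ha : 0 < a) (hb : 0 < b) (hab : a + b = 1) {A B M : Set E}
    (hA : MeasurableSet A) (hB : MeasurableSet B) (hM : MeasurableSet M)
    (h : ∀ x ∈ A, ∀ y ∈ B, a • x + b • y ∈ M) : μ A ^ a * μ B ^ b ≤ μ M := by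
  let n := Module.finrank ℝ E
  let φ : E ≃L[ℝ] (Fin n → ℝ) := ContinuousLinearEquiv.ofFinrankEq (by simp [n])
  let ψ : E ≃ᵐ (Fin n → ℝ) := φ.toHomeomorph.toMeasurableEquiv
  have hφ : (μ.map φ).IsAddHaarMeasure := φ.isAddHaarMeasure_map μ
  obtain ⟨c, hc⟩ : ∃ c : NNReal, μ.map φ = c • (volume : Measure (Fin n → ℝ)) :=
    ⟨_, Measure.isAddLeftInvariant_eq_smul (μ.map φ) volume⟩
  have hμ : ∀ S : Set E, μ S = c * volume (φ.symm ⁻¹' S) := by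
    intro S
    have h1 : μ.map φ (φ.symm ⁻¹' S) = μ S := by
      have := ψ.map_apply (μ := μ) (φ.symm ⁻¹' S)
      have h2 : ψ ⁻¹' (φ.symm ⁻¹' S) = S := by
        ext x
        simp [ψ]
      rw [h2] at this
      exact this
    rw [← h1, hc]
    rfl
  have meas : ∀ {S : Set E}, MeasurableSet S → MeasurableSet (φ.symm ⁻¹' S) := fun hS =>
    hS.preimage φ.symm.continuous.measurable
  have key := lintegral_rpow_mul_rpow_le ha hb hab
    (measurable_one.indicator (meas hA)) (measurable_one.indicator (meas hB))
    (measurable_one.indicator (meas hM)) (fun x y => by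
      by_cases hx : φ.symm x ∈ A
      · by_cases hy : φ.symm y ∈ B
        · have hxy := h _ hx _ hy
          simp only [indicator, mem_preimage, hx, hy, map_add, map_smul, hxy]
          simp
        · simp [indicator, hy, hb]
      · simp [indicator, hx, ha])
  rw [lintegral_indicator_one (meas hA), lintegral_indicator_one (meas hB),
    lintegral_indicator_one (meas hM)] at key
  rw [hμ A, hμ B, hμ M, ENNReal.mul_rpow_of_nonneg _ _ ha.le, ENNReal.mul_rpow_of_nonneg _ _ hb.le,
    mul_mul_mul_comm, ← ENNReal.rpow_add_of_nonneg _ _ ha.le hb.le, hab, ENNReal.rpow_one]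
  gcongr

/-! ### Halfspaces through the centroid -/

/-- The distribution function of a real random variable, evaluated at that variable, is
stochastically at least uniform on `[0, 1]`. -/
theorem measure_setOf_measureReal_Iic_le (ν : Measure ℝ) [IsFiniteMeasure ν] (r : ℝ) :
    ν {t | ν.real (Iic t) ≤ r} ≤ ENNReal.ofReal r := by
  have hmono : Monotone fun t => ν.real (Iic t) := fun s t hst =>
    measureReal_mono (Iic_subset_Iic.2 hst)
  have hmeas : MeasurableSet {t | ν.real (Iic t) ≤ r} :=
    measurableSet_le hmono.measurable measurable_const
  rw [hmeas.measure_eq_iSup_isCompact]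
  refine iSup_le fun K => iSup_le fun hK => iSup_le fun hKc => ?_
  rcases K.eq_empty_or_nonempty with rfl | hne
  · simp
  obtain ⟨τ, hτ, hτ'⟩ := hKc.exists_isGreatest hne
  calc ν K ≤ ν (Iic τ) := measure_mono fun x hx => hτ' hx
    _ = ENNReal.ofReal (ν.real (Iic τ)) := (ofReal_measureReal).symm
    _ ≤ ENNReal.ofReal r := ENNReal.ofReal_le_ofReal (hK hτ)

/-- A convex function on a subset of `ℝ` has an affine minorant touching it at any interior
point. -/
theorem ConvexOn.exists_affine_le_of_mem_interior {S : Set ℝ} {f : ℝ → ℝ} (hf : ConvexOn ℝ S f)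
    {m : ℝ} (hm : m ∈ interior S) : ∃ s : ℝ, ∀ t ∈ S, f m + s * (t - m) ≤ f t := by
  refine ⟨derivWithin f (Ioi m) m, fun t ht => ?_⟩
  rcases lt_trichotomy t m with h | rfl | h
  · have h1 := (hf.slope_le_leftDeriv_of_mem_interior ht hm h).trans
      (hf.leftDeriv_le_rightDeriv_of_mem_interior hm)
    rw [slope_def_field, div_le_iff₀ (sub_pos.2 h)] at h1
    linarith
  · simp
  · have h1 := hf.rightDeriv_le_slope_of_mem_interior hm ht h
    rw [slope_def_field, le_div_iff₀ (sub_pos.2 h)] at h1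
    linarith

/-- A random variable `X` whose distribution function `p` is log-concave satisfies
`P(X ≤ E X) ≥ 1/e`. Jensen's inequality for `log p` gives `log p(E X) ≥ E log p(X)`, and the right
side is at least `-1` because `p(X)` is stochastically at least uniform on `[0, 1]`. -/
theorem exp_neg_one_le_measureReal_Iic_integral (ν : Measure ℝ) [IsProbabilityMeasure ν]
    [NullSingletonClass ν] (hint : Integrable (fun x => x) ν)
    (hlog : ∀ s t a b : ℝ, 0 < a → 0 < b → a + b = 1 →
      ν (Iic s) ^ a * ν (Iic t) ^ b ≤ ν (Iic (a * s + b * t))) :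
    Real.exp (-1) ≤ ν.real (Iic (∫ x, x ∂ν)) := by
  set m := ∫ x, x ∂ν with hm
  set p : ℝ → ℝ := fun t => ν.real (Iic t) with hp
  have hmono : Monotone p := fun s t hst => measureReal_mono (Iic_subset_Iic.2 hst)
  have hp1 : ∀ t, p t ≤ 1 := fun t => measureReal_le_one
  have hp0 : ∀ t, 0 ≤ p t := fun t => measureReal_nonneg
  obtain ⟨t₀, ht₀, ht₀'⟩ : ∃ t < m, 0 < p t := by
    have h1 : 0 < ν (Iic m) := measure_le_integral_pos hint
    rw [← Iio_ae_eq_Iic.measure_eq] at h1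
    obtain ⟨K, hK, hKc, hK0⟩ := (measurableSet_Iio (a := m)).exists_lt_isCompact h1
    have hne : K.Nonempty := nonempty_of_measure_ne_zero hK0.ne'
    obtain ⟨τ, hτ, hτ'⟩ := hKc.exists_isGreatest hne
    refine ⟨τ, hK hτ, ?_⟩
    exact ENNReal.toReal_pos (hK0.trans_le (measure_mono fun x hx => hτ' hx)).ne'
      (measure_ne_top _ _)
  have hlogp : ∀ s t a b : ℝ, 0 < a → 0 < b → a + b = 1 →
      p s ^ a * p t ^ b ≤ p (a * s + b * t) := by
    intro s t a b ha hb hab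
    have := ENNReal.toReal_mono (measure_ne_top _ _) (hlog s t a b ha hb hab)
    rwa [ENNReal.toReal_mul, ← ENNReal.toReal_rpow, ← ENNReal.toReal_rpow] at this
  have hpos : ∀ s t a b : ℝ, 0 < a → 0 < b → a + b = 1 → 0 < p s → 0 < p t →
      0 < p (a * s + b * t) := fun s t a b ha hb hab hs ht =>
    lt_of_lt_of_le (mul_pos (Real.rpow_pos_of_pos hs a) (Real.rpow_pos_of_pos ht b))
      (hlogp s t a b ha hb hab)
  have hconv : ConvexOn ℝ {t | 0 < p t} (fun t => -Real.log (p t)) := by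
    rw [convexOn_iff_forall_pos]
    refine ⟨?_, ?_⟩
    · rw [convex_iff_forall_pos]
      exact fun s hs t ht a b ha hb hab => hpos s t a b ha hb hab hs ht
    · intro s hs t ht a b ha hb hab
      have h1 := Real.log_le_log (mul_pos (Real.rpow_pos_of_pos hs a) (Real.rpow_pos_of_pos ht b))
        (hlogp s t a b ha hb hab)
      rw [Real.log_mul (Real.rpow_pos_of_pos hs a).ne' (Real.rpow_pos_of_pos ht b).ne',
        Real.log_rpow hs, Real.log_rpow ht] at h1
      simp only [smul_eq_mul]
      linarith
  have hmint : m ∈ interior {t | 0 < p t} := by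
    refine mem_interior.2 ⟨Ioi t₀, fun t ht => ?_, isOpen_Ioi, ht₀⟩
    exact ht₀'.trans_le (hmono (le_of_lt ht))
  obtain ⟨s, hs⟩ := hconv.exists_affine_le_of_mem_interior hmint
  have hae : ∀ᵐ t ∂ν, 0 < p t := by
    have h0 : ν {t | p t ≤ 0} = 0 := by
      simpa using measure_setOf_measureReal_Iic_le ν 0
    rw [ae_iff]
    simpa only [not_lt] using h0
  have hfm : Measurable fun t => -Real.log (p t) :=
    (Real.measurable_log.comp hmono.measurable).neg
  have hf0 : ∀ t, 0 ≤ -Real.log (p t) := fun t =>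
    neg_nonneg.2 (Real.log_nonpos (hp0 t) (hp1 t))
  have hl : ∫⁻ t, ENNReal.ofReal (-Real.log (p t)) ∂ν ≤ 1 := by
    rw [lintegral_eq_lintegral_meas_le ν (Filter.Eventually.of_forall hf0) hfm.aemeasurable]
    have hexp : ∫⁻ r in Ioi (0 : ℝ), ENNReal.ofReal (Real.exp (-r)) = 1 := by
      rw [← ofReal_integral_eq_lintegral_ofReal (integrableOn_exp_neg_Ioi 0)
        (Filter.Eventually.of_forall fun r => (Real.exp_pos _).le), integral_exp_neg_Ioi_zero,
        ENNReal.ofReal_one]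
    rw [← hexp]
    refine lintegral_mono fun r => le_trans (measure_mono fun t ht => ?_)
      (measure_setOf_measureReal_Iic_le ν _)
    rcases (hp0 t).eq_or_lt with h | h
    · change p t ≤ _
      rw [← h]
      positivity
    · change p t ≤ _
      rw [← Real.log_le_iff_le_exp h]
      have : r ≤ -Real.log (p t) := ht
      linarith
  have hfi : Integrable (fun t => -Real.log (p t)) ν :=
    ⟨hfm.aestronglyMeasurable, by
      rw [hasFiniteIntegral_iff_ofReal (Filter.Eventually.of_forall hf0)]
      exact hl.trans_lt (by simp)⟩
  have h1 : ∫ t, -Real.log (p t) ∂ν ≤ 1 := by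
    rw [integral_eq_lintegral_of_nonneg_ae (Filter.Eventually.of_forall hf0)
      hfm.aestronglyMeasurable]
    simpa using ENNReal.toReal_mono ENNReal.one_ne_top hl
  have hia : Integrable (fun t => s * (t - m)) ν := (hint.sub (integrable_const m)).const_mul s
  have h2 : ∫ t, (-Real.log (p m) + s * (t - m)) ∂ν ≤ ∫ t, -Real.log (p t) ∂ν := by
    refine integral_mono_ae ((integrable_const _).add hia) hfi ?_
    filter_upwards [hae] with t ht using hs t ht
  have h3 : ∫ t, (-Real.log (p m) + s * (t - m)) ∂ν = -Real.log (p m) := by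
    rw [integral_add (integrable_const _) hia, integral_const_mul,
      integral_sub hint (integrable_const m), ← hm]
    simp
  have hpm : 0 < p m := ht₀'.trans_le (hmono ht₀.le)
  rw [← Real.le_log_iff_exp_le hpm]
  linarith

section Grunbaum

variable {E : Type*} [NormedAddCommGroup E] [NormedSpace ℝ E] [FiniteDimensional ℝ E]
  [MeasurableSpace E] [BorelSpace E] (μ : Measure E) [μ.IsAddHaarMeasure]

/-- The centroid of a set with respect to a measure. -/
noncomputable def centroidOf (C : Set E) : E := ∫ y, y ∂(ProbabilityTheory.cond μ C)

/-- Grünbaum's inequality with the dimension-free constant `1/e`: a halfspace containing the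
centroid of a convex body contains at least `1/e` of its volume. -/
theorem measure_le_exp_one_mul_measure_inter_centroid_le {C : Set E} (hC : Convex ℝ C)
    (hCc : IsCompact C) (hCi : (interior C).Nonempty) (L : E →L[ℝ] ℝ) :
    μ C ≤ ENNReal.ofReal (Real.exp 1) * μ (C ∩ {y | L y ≤ L (centroidOf μ C)}) := by
  have hC0 : μ C ≠ 0 := (Measure.measure_pos_of_nonempty_interior μ hCi).ne'
  have hCt : μ C ≠ ⊤ := hCc.measure_lt_top.ne
  rcases eq_or_ne L 0 with rfl | hL
  · simp only [zero_apply, le_refl, Set.ofPred_true, inter_univ]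
    refine le_mul_of_one_le_left (by simp) ?_
    rw [ENNReal.one_le_ofReal]
    exact Real.one_le_exp zero_le_one
  have hprob : IsProbabilityMeasure (ProbabilityTheory.cond μ C) :=
    ProbabilityTheory.cond_isProbabilityMeasure_of_finite hC0 hCt
  set P := ProbabilityTheory.cond μ C with hP
  have hPapply : ∀ S, P S = (μ C)⁻¹ * μ (C ∩ S) := fun S =>
    ProbabilityTheory.cond_apply hCc.measurableSet μ S
  have hLm : Measurable L := L.continuous.measurable
  have hνapply : ∀ S, MeasurableSet S → P.map L S = (μ C)⁻¹ * μ (C ∩ L ⁻¹' S) := fun S hS => by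
    rw [Measure.map_apply hLm hS, hPapply]
  have hν : IsProbabilityMeasure (P.map L) := Measure.isProbabilityMeasure_map hLm.aemeasurable
  have hintE : Integrable (fun y : E => y) P :=
    (continuousOn_id.integrableOn_compact hCc).smul_measure (by simp [hC0])
  have hatoms : NullSingletonClass (P.map L) := by
    refine ⟨fun x => ?_⟩
    obtain ⟨v, hv⟩ : ∃ v, L v ≠ 0 := by
      by_contra! h
      exact hL (ContinuousLinearMap.ext h)
    have h0 : μ (L ⁻¹' {x}) = 0 := by
      let w : E := (x / L v) • v
      have hw : L w = x := by simp [w, hv]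
      have h1 : L ⁻¹' {x} = (fun y => y + -w) ⁻¹' (L.toLinearMap.ker : Set E) := by
        ext y
        simp [hw, add_neg_eq_zero]
      rw [h1, measure_preimage_add_right]
      refine Measure.addHaar_submodule μ _ fun htop => hv ?_
      have : v ∈ L.toLinearMap.ker := htop ▸ Submodule.mem_top
      simpa using this
    rw [hνapply _ (measurableSet_singleton x), measure_mono_null inter_subset_right h0, mul_zero]
  have hint : Integrable (fun x : ℝ => x) (P.map L) := by
    rw [integrable_map_measure (by fun_prop) hLm.aemeasurable]
    exact L.integrable_comp hintE
  have hmean : ∫ x, x ∂(P.map L) = L (centroidOf μ C) := by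
    rw [integral_map hLm.aemeasurable (by fun_prop), centroidOf, L.integral_comp_comm hintE]
  have key := exp_neg_one_le_measureReal_Iic_integral (P.map L) hint (by
    intro s t a b ha hb hab
    rw [hνapply _ measurableSet_Iic, hνapply _ measurableSet_Iic, hνapply _ measurableSet_Iic,
      ENNReal.mul_rpow_of_nonneg _ _ ha.le, ENNReal.mul_rpow_of_nonneg _ _ hb.le,
      mul_mul_mul_comm, ← ENNReal.rpow_add_of_nonneg _ _ ha.le hb.le, hab, ENNReal.rpow_one]
    gcongr
    have hm : ∀ r, MeasurableSet (C ∩ L ⁻¹' Iic r) := fun r =>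
      hCc.measurableSet.inter (measurableSet_Iic.preimage hLm)
    refine measure_rpow_mul_rpow_le_of_combination_mem μ ha hb hab (hm _) (hm _) (hm _) ?_
    rintro x ⟨hx, hxs⟩ y ⟨hy, hyt⟩
    refine ⟨hC hx hy ha.le hb.le hab, ?_⟩
    simp only [mem_preimage, mem_Iic, map_add, map_smul, smul_eq_mul] at hxs hyt ⊢
    gcongr)
  rw [hmean] at key
  have key' := ENNReal.ofReal_le_ofReal key
  rw [ofReal_measureReal, hνapply _ measurableSet_Iic] at key'
  have hexp : ENNReal.ofReal (Real.exp 1) * ENNReal.ofReal (Real.exp (-1)) = 1 := by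
    rw [← ENNReal.ofReal_mul (Real.exp_pos _).le, ← Real.exp_add]
    simp
  calc μ C = ENNReal.ofReal (Real.exp 1) * (μ C * ENNReal.ofReal (Real.exp (-1))) := by
        rw [mul_left_comm, hexp, mul_one]
    _ ≤ ENNReal.ofReal (Real.exp 1) *
        (μ C * ((μ C)⁻¹ * μ (C ∩ L ⁻¹' Iic (L (centroidOf μ C))))) := by gcongr
    _ = _ := by
        rw [← mul_assoc (μ C), ENNReal.mul_inv_cancel hC0 hCt, one_mul]
        rfl

/-- The centroid of a convex body belongs to it. -/
theorem centroidOf_mem {C : Set E} (hC : Convex ℝ C) (hCc : IsCompact C)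
    (hCi : (interior C).Nonempty) : centroidOf μ C ∈ C := by
  have hC0 : μ C ≠ 0 := (Measure.measure_pos_of_nonempty_interior μ hCi).ne'
  have hprob : IsProbabilityMeasure (ProbabilityTheory.cond μ C) :=
    ProbabilityTheory.cond_isProbabilityMeasure_of_finite hC0 hCc.measure_lt_top.ne
  exact hC.integral_mem hCc.isClosed (ProbabilityTheory.ae_cond_mem hCc.measurableSet)
    ((continuousOn_id.integrableOn_compact hCc).smul_measure (by simp [hC0]))

end Grunbaum

/-! ### Summation over the integers and integration -/

/-- The counting measure of `ℤ`, as a measure on `ℝ`. -/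
noncomputable def intMeasure : Measure ℝ := Measure.count.map ((↑) : ℤ → ℝ)

theorem measurable_intCast_real : Measurable ((↑) : ℤ → ℝ) := measurable_from_top

theorem intMeasure_apply {S : Set ℝ} (hS : MeasurableSet S) :
    intMeasure S = Measure.count (((↑) : ℤ → ℝ) ⁻¹' S) :=
  Measure.map_apply measurable_intCast_real hS

theorem lintegral_intMeasure {f : ℝ → ℝ≥0∞} (hf : Measurable f) :
    ∫⁻ t, f t ∂intMeasure = ∑' z : ℤ, f z := by
  rw [intMeasure, lintegral_map hf measurable_intCast_real, lintegral_count]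

/-- The length of a bounded interval exceeds its number of integers by at most `1`. -/
theorem Set.OrdConnected.volume_le_intMeasure_add_one {I : Set ℝ} (hI : I.OrdConnected)
    (hI' : Bornology.IsBounded I) : volume I ≤ intMeasure I + 1 := by
  rcases I.eq_empty_or_nonempty with rfl | hne
  · simp
  set a := sInf I
  set b := sSup I
  have hsub : I ⊆ Icc a b := subset_Icc_csInf_csSup hI'.bddBelow hI'.bddAbove
  have hsup : Ioo a b ⊆ I :=
    IsConnected.Ioo_csInf_csSup_subset ⟨hne, hI.isPreconnected⟩ hI'.bddBelow
      hI'.bddAbove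
  have h1 : ENNReal.ofReal (b - a) ≤ intMeasure (Ioo a b) + 1 := by
    rw [intMeasure_apply measurableSet_Ioo, Int.preimage_Ioo, ← Finset.coe_Ioo,
      Measure.count_apply_finset, Int.card_Ioo]
    refine ENNReal.ofReal_le_of_le_toReal ?_
    rw [ENNReal.toReal_add (by simp) (by simp), ENNReal.toReal_natCast, ENNReal.toReal_one]
    have h2 : ((⌈b⌉ - ⌊a⌋ - 1 : ℤ) : ℝ) ≤ ((⌈b⌉ - ⌊a⌋ - 1).toNat : ℝ) := by
      exact_mod_cast Int.self_le_toNat _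
    push_cast at h2
    linarith [Int.le_ceil b, Int.floor_le a]
  calc volume I ≤ volume (Icc a b) := measure_mono hsub
    _ = ENNReal.ofReal (b - a) := Real.volume_Icc
    _ ≤ intMeasure (Ioo a b) + 1 := h1
    _ ≤ intMeasure I + 1 := by gcongr

/-- The number of integers in a bounded interval exceeds its length by at most `1`. -/
theorem Set.OrdConnected.intMeasure_le_volume_add_one {I : Set ℝ} (hI : I.OrdConnected)
    (hI' : Bornology.IsBounded I) : intMeasure I ≤ volume I + 1 := by
  rcases I.eq_empty_or_nonempty with rfl | hne
  · simp
  set a := sInf I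
  set b := sSup I
  have hsub : I ⊆ Icc a b := subset_Icc_csInf_csSup hI'.bddBelow hI'.bddAbove
  have hsup : Ioo a b ⊆ I :=
    IsConnected.Ioo_csInf_csSup_subset ⟨hne, hI.isPreconnected⟩ hI'.bddBelow
      hI'.bddAbove
  have hab : a ≤ b := by
    obtain ⟨x, hx⟩ := hne
    exact (hsub hx).1.trans (hsub hx).2
  have h1 : intMeasure (Icc a b) ≤ ENNReal.ofReal (b - a) + 1 := by
    rw [intMeasure_apply measurableSet_Icc, Int.preimage_Icc, ← Finset.coe_Icc,
      Measure.count_apply_finset, Int.card_Icc, ← ENNReal.ofReal_one,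
      ← ENNReal.ofReal_add (sub_nonneg.2 hab) zero_le_one, ← ENNReal.ofReal_natCast]
    refine ENNReal.ofReal_le_ofReal ?_
    have h2 : (((⌊b⌋ + 1 - ⌈a⌉).toNat : ℤ) : ℝ) = ((max (⌊b⌋ + 1 - ⌈a⌉) 0 : ℤ) : ℝ) := by
      rw [Int.toNat_eq_max]
    have h3 : (((⌊b⌋ + 1 - ⌈a⌉).toNat : ℕ) : ℝ) = max ((⌊b⌋ : ℝ) + 1 - ⌈a⌉) 0 := by
      rw [← Int.cast_natCast, h2]
      push_cast
      rfl
    rw [h3]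
    exact max_le (by linarith [Int.floor_le b, Int.le_ceil a]) (by linarith)
  calc intMeasure I ≤ intMeasure (Icc a b) := measure_mono hsub
    _ ≤ ENNReal.ofReal (b - a) + 1 := h1
    _ = volume (Ioo a b) + 1 := by rw [Real.volume_Ioo]
    _ ≤ volume I + 1 := by gcongr

/-- If two measures differ by at most `1` on the superlevel sets of a function bounded by `M`, then
its integrals differ by at most `M`. -/
theorem lintegral_le_lintegral_add_of_measure_superlevel_le {α : Type*} [MeasurableSpace α]
    {μ ν : Measure α} {h : α → ℝ≥0∞} (hh : Measurable h) {M : ℝ≥0∞} (hM : M ≠ ⊤)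
    (hhM : ∀ x, h x ≤ M)
    (H : ∀ t : ℝ, 0 < t → μ {x | ENNReal.ofReal t < h x} ≤ ν {x | ENNReal.ofReal t < h x} + 1) :
    ∫⁻ x, h x ∂μ ≤ ∫⁻ x, h x ∂ν + M := by
  have hfin : ∀ x, h x ≠ ⊤ := fun x => ne_top_of_le_ne_top hM (hhM x)
  rw [lintegral_eq_lintegral_measure_ofReal_lt μ hh hfin,
    lintegral_eq_lintegral_measure_ofReal_lt ν hh hfin]
  have hM' : M = ∫⁻ t in Ioi (0 : ℝ), (Iio M.toReal).indicator 1 t := by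
    rw [lintegral_indicator_one measurableSet_Iio, Measure.restrict_apply measurableSet_Iio,
      Iio_inter_Ioi, Real.volume_Ioo, sub_zero, ENNReal.ofReal_toReal hM]
  conv_rhs => rw [hM']
  rw [← lintegral_add_right _ (measurable_one.indicator measurableSet_Iio)]
  refine setLIntegral_mono' measurableSet_Ioi fun t ht => ?_
  by_cases htM : t < M.toReal
  · simpa [indicator, htM] using H t ht
  · have hempty : {x | ENNReal.ofReal t < h x} = ∅ := by
      refine eq_empty_of_forall_notMem fun x hx => htM ?_
      exact (ENNReal.ofReal_lt_iff_lt_toReal (le_of_lt ht) hM).1 (lt_of_lt_of_le hx (hhM x))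
    simp [hempty]

/-! ### Sections of convex bodies -/

/-- The volume of the section of `D ⊆ ℝ × F` over `t ∈ ℝ`. -/
noncomputable def sectionVolume {F : Type*} [MeasurableSpace F] (μ : Measure F) (D : Set (ℝ × F))
    (t : ℝ) : ℝ≥0∞ :=
  μ (Prod.mk t ⁻¹' D)

theorem measurable_sectionVolume {F : Type*} [MeasurableSpace F] {μ : Measure F} [SFinite μ]
    {D : Set (ℝ × F)} (hD : MeasurableSet D) : Measurable (sectionVolume μ D) :=
  measurable_measure_prodMk_left hD

theorem lintegral_sectionVolume {F : Type*} [MeasurableSpace F] {μ : Measure F} [SFinite μ]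
    {D : Set (ℝ × F)} (hD : MeasurableSet D) :
    ∫⁻ t, sectionVolume μ D t = ((volume : Measure ℝ).prod μ) D :=
  (Measure.prod_apply hD).symm

theorem sectionVolume_mono {F : Type*} [MeasurableSpace F] {μ : Measure F} {D D' : Set (ℝ × F)}
    (h : D ⊆ D') (t : ℝ) : sectionVolume μ D t ≤ sectionVolume μ D' t :=
  measure_mono (preimage_mono h)

theorem isBounded_setOf_lt_sectionVolume {F : Type*} [TopologicalSpace F] [MeasurableSpace F]
    {μ : Measure F} {D : Set (ℝ × F)} (hDc : IsCompact D) (r : ℝ≥0∞) :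
    Bornology.IsBounded {t | r < sectionVolume μ D t} := by
  refine (hDc.image continuous_fst).isBounded.subset fun t ht => ?_
  obtain ⟨y, hy⟩ : (Prod.mk t ⁻¹' D).Nonempty :=
    nonempty_of_measure_ne_zero (μ := μ) (ne_of_gt (lt_of_le_of_lt zero_le ht))
  exact ⟨(t, y), hy, rfl⟩

section Sections

variable {F : Type*} [NormedAddCommGroup F] [NormedSpace ℝ F] [FiniteDimensional ℝ F]
  [MeasurableSpace F] [BorelSpace F] {μ : Measure F} [μ.IsAddHaarMeasure]

/-- The section volumes of a compact convex set are quasiconcave, by the Brunn–Minkowski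
inequality. -/
theorem ordConnected_setOf_lt_sectionVolume {D : Set (ℝ × F)} (hD : Convex ℝ D)
    (hDc : IsCompact D) (r : ℝ≥0∞) : {t | r < sectionVolume μ D t}.OrdConnected := by
  rw [← convex_iff_ordConnected, convex_iff_forall_pos]
  intro s hs t ht a b ha hb hab
  have hm : ∀ u : ℝ, MeasurableSet (Prod.mk u ⁻¹' D) := fun u =>
    hDc.measurableSet.preimage measurable_prodMk_left
  refine lt_of_lt_of_le ?_ (measure_rpow_mul_rpow_le_of_combination_mem μ ha hb hab (hm s) (hm t)
    (hm (a * s + b * t)) fun x hx y hy => hD hx hy ha.le hb.le hab)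
  calc r = r ^ a * r ^ b := by
        rw [← ENNReal.rpow_add_of_nonneg _ _ ha.le hb.le, hab, ENNReal.rpow_one]
    _ < _ := ENNReal.mul_lt_mul (ENNReal.rpow_lt_rpow hs ha) (ENNReal.rpow_lt_rpow ht hb)

theorem volume_le_lintegral_sectionVolume_intMeasure_add {D : Set (ℝ × F)} (hD : Convex ℝ D)
    (hDc : IsCompact D) {M : ℝ≥0∞} (hM : M ≠ ⊤) (hDM : ∀ t, sectionVolume μ D t ≤ M) :
    ((volume : Measure ℝ).prod μ) D ≤ ∫⁻ t, sectionVolume μ D t ∂intMeasure + M := by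
  rw [← lintegral_sectionVolume hDc.measurableSet]
  exact lintegral_le_lintegral_add_of_measure_superlevel_le
    (measurable_sectionVolume hDc.measurableSet) hM hDM fun t _ =>
      (ordConnected_setOf_lt_sectionVolume hD hDc _).volume_le_intMeasure_add_one
        (isBounded_setOf_lt_sectionVolume hDc _)

theorem lintegral_sectionVolume_intMeasure_le_volume_add {D : Set (ℝ × F)} (hD : Convex ℝ D)
    (hDc : IsCompact D) {M : ℝ≥0∞} (hM : M ≠ ⊤) (hDM : ∀ t, sectionVolume μ D t ≤ M) :
    ∫⁻ t, sectionVolume μ D t ∂intMeasure ≤ ((volume : Measure ℝ).prod μ) D + M := by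
  rw [← lintegral_sectionVolume hDc.measurableSet]
  exact lintegral_le_lintegral_add_of_measure_superlevel_le
    (measurable_sectionVolume hDc.measurableSet) hM hDM fun t _ =>
      (ordConnected_setOf_lt_sectionVolume hD hDc _).intMeasure_le_volume_add_one
        (isBounded_setOf_lt_sectionVolume hDc _)

/-- Shrinking the section over `t` towards a point of the convex set by a factor at least
`1 - 1/(2d)`, `d = dim F`, keeps at least half of its volume, so the sections over an interval of
length `|p.1 - t| / (2d)` are at least half as large as the one over `t`. -/
theorem sectionVolume_mul_dist_le {D : Set (ℝ × F)} (hD : Convex ℝ D) (hDc : IsCompact D)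
    (hd : 1 ≤ Module.finrank ℝ F) {p : ℝ × F} (hp : p ∈ D) (t : ℝ) :
    sectionVolume μ D t * ENNReal.ofReal |p.1 - t| ≤
      ENNReal.ofReal (4 * Module.finrank ℝ F) * ((volume : Measure ℝ).prod μ) D := by
  set d := Module.finrank ℝ F with hd_def
  have hd' : (1 : ℝ) ≤ d := by exact_mod_cast hd
  have hd0 : (0 : ℝ) < d := by linarith
  set J := (fun σ : ℝ => (p.1 - t) * σ + t) '' Icc 0 (1 / (2 * d)) with hJ
  have hJsec : ∀ τ ∈ J, ENNReal.ofReal (1 / 2) * sectionVolume μ D t ≤ sectionVolume μ D τ := by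
    rintro _ ⟨σ, ⟨hσ0, hσ1⟩, rfl⟩
    have hdσ : d * σ ≤ 1 / 2 := by
      calc d * σ ≤ d * (1 / (2 * d)) := by gcongr
        _ = 1 / 2 := by field_simp
    have hσ : σ ≤ 1 / 2 := by nlinarith
    have hb := one_add_mul_le_pow (a := -σ) (by linarith) d
    have hsub : AffineMap.homothety p.2 (1 - σ) '' (Prod.mk t ⁻¹' D) ⊆
        Prod.mk ((p.1 - t) * σ + t) ⁻¹' D := by
      rintro _ ⟨y, hy, rfl⟩
      have := hD (show (t, y) ∈ D from hy) hp (sub_nonneg.2 (by linarith : σ ≤ 1)) hσ0 (by ring)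
      refine Eq.subst (motive := (· ∈ D)) (Prod.ext ?_ ?_) this
      · simp
        ring
      · simp [AffineMap.homothety_apply, smul_sub, sub_smul]
        abel
    refine le_trans ?_ (measure_mono hsub)
    rw [Measure.addHaar_image_homothety, ← hd_def]
    refine mul_le_mul' (ENNReal.ofReal_le_ofReal ?_) le_rfl
    refine le_trans ?_ (le_abs_self _)
    have : (1 + -σ) = 1 - σ := by ring
    rw [this] at hb
    linarith
  have hJvol : ENNReal.ofReal (1 / (2 * d)) * ENNReal.ofReal |p.1 - t| = volume J := by
    have : J = (fun x => x + t) '' ((p.1 - t) • Icc 0 (1 / (2 * (d : ℝ)))) := by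
      rw [hJ, ← image_smul, image_image]; rfl
    rw [this, image_add_right, measure_preimage_add_right, Measure.addHaar_smul, Real.volume_Icc]
    simp [mul_comm]
  have hJm : MeasurableSet J := (isCompact_Icc.image (by fun_prop)).measurableSet
  have hV : ENNReal.ofReal (1 / 2) * sectionVolume μ D t * volume J ≤
      ((volume : Measure ℝ).prod μ) D := by
    rw [← lintegral_sectionVolume hDc.measurableSet, ← setLIntegral_const]
    exact (setLIntegral_mono' hJm hJsec).trans (setLIntegral_le_lintegral _ _)
  rw [← hJvol] at hV
  calc sectionVolume μ D t * ENNReal.ofReal |p.1 - t|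
      = ENNReal.ofReal (4 * d) * ENNReal.ofReal (1 / 2) * ENNReal.ofReal (1 / (2 * d)) *
          (sectionVolume μ D t * ENNReal.ofReal |p.1 - t|) := by
        rw [← ENNReal.ofReal_mul (by positivity), ← ENNReal.ofReal_mul (by positivity)]
        have : 4 * (d : ℝ) * (1 / 2) * (1 / (2 * d)) = 1 := by
          field_simp
          norm_num
        rw [this, ENNReal.ofReal_one, one_mul]
    _ = ENNReal.ofReal (4 * d) * (ENNReal.ofReal (1 / 2) * sectionVolume μ D t *
          (ENNReal.ofReal (1 / (2 * d)) * ENNReal.ofReal |p.1 - t|)) := by ring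
    _ ≤ _ := by gcongr

/-- If the first coordinates of a compact convex set include `0` and `k`, then one of these is at
distance at least `k / 2` from any given `t`, so every section has volume `O(d / k)` times the
total. -/
theorem sectionVolume_le {D : Set (ℝ × F)} (hD : Convex ℝ D) (hDc : IsCompact D)
    (hd : 1 ≤ Module.finrank ℝ F) {k : ℝ} (hk : 0 < k) {p q : ℝ × F} (hp : p ∈ D) (hq : q ∈ D)
    (hp0 : p.1 = 0) (hqk : q.1 = k) (t : ℝ) :
    sectionVolume μ D t ≤ ENNReal.ofReal (8 * (Module.finrank ℝ F / k)) *
      ((volume : Measure ℝ).prod μ) D := by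
  have key : sectionVolume μ D t * ENNReal.ofReal (k / 2) ≤
      ENNReal.ofReal (4 * Module.finrank ℝ F) * ((volume : Measure ℝ).prod μ) D := by
    rcases le_total t (k / 2) with h | h
    · refine le_trans ?_ (sectionVolume_mul_dist_le hD hDc hd hq t)
      gcongr
      rw [hqk]
      exact le_trans (by linarith) (le_abs_self _)
    · refine le_trans ?_ (sectionVolume_mul_dist_le hD hDc hd hp t)
      gcongr
      rw [hp0]
      exact le_trans (by linarith) (neg_le_abs _)
  calc sectionVolume μ D t
      = ENNReal.ofReal (2 / k) * (sectionVolume μ D t * ENNReal.ofReal (k / 2)) := by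
        rw [mul_left_comm, ← ENNReal.ofReal_mul (by positivity),
          show 2 / k * (k / 2) = 1 by field_simp, ENNReal.ofReal_one, mul_one]
    _ ≤ ENNReal.ofReal (2 / k) *
        (ENNReal.ofReal (4 * Module.finrank ℝ F) * ((volume : Measure ℝ).prod μ) D) := by gcongr
    _ = _ := by
        rw [← mul_assoc, ← ENNReal.ofReal_mul (by positivity)]
        congr 2
        ring

end Sections

/-! ### Centrepoints with an integer coordinate -/

/-- Moving from the centroid towards a point `p` of the convex body by a fraction `s` costs at most
a factor `(1 - s) ^ n` in Grünbaum's inequality: the homothety with centre `p` and ratio `1 - s`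
maps the body into itself and the halfspaces at the centroid to those at the new point. -/
theorem pow_mul_measure_le_measure_inter_halfspace {E : Type*} [NormedAddCommGroup E]
    [NormedSpace ℝ E] [FiniteDimensional ℝ E] [MeasurableSpace E] [BorelSpace E] (μ : Measure E)
    [μ.IsAddHaarMeasure] {C : Set E} (hC : Convex ℝ C) (hCc : IsCompact C)
    (hCi : (interior C).Nonempty) (L : E →L[ℝ] ℝ) {p : E} (hp : p ∈ C) {s : ℝ} (hs0 : 0 ≤ s)
    (hs1 : s ≤ 1) :
    ENNReal.ofReal ((1 - s) ^ Module.finrank ℝ E) * μ C ≤ ENNReal.ofReal (Real.exp 1) *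
      μ (C ∩ {y | L ((1 - s) • centroidOf μ C + s • p) ≤ L y}) := by
  set c := centroidOf μ C
  have hs : 0 ≤ 1 - s := sub_nonneg.2 hs1
  have hG := measure_le_exp_one_mul_measure_inter_centroid_le μ hC hCc hCi (-L)
  simp only [neg_apply, neg_le_neg_iff] at hG
  have hsub : AffineMap.homothety p (1 - s) '' (C ∩ {y | L c ≤ L y}) ⊆
      C ∩ {y | L ((1 - s) • c + s • p) ≤ L y} := by
    rintro _ ⟨y, ⟨hy, hLy⟩, rfl⟩
    have e : AffineMap.homothety p (1 - s) y = (1 - s) • y + s • p := by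
      rw [AffineMap.homothety_apply]
      simp only [vsub_eq_sub, vadd_eq_add, smul_sub, sub_smul, one_smul]
      abel
    rw [e]
    refine ⟨hC hy hp hs hs0 (by ring), ?_⟩
    have hLy' : L c ≤ L y := hLy
    simp only [mem_ofPred_eq, map_add, map_smul, smul_eq_mul]
    gcongr
  calc _ ≤ ENNReal.ofReal ((1 - s) ^ Module.finrank ℝ E) *
        (ENNReal.ofReal (Real.exp 1) * μ (C ∩ {y | L c ≤ L y})) := by gcongr
    _ = ENNReal.ofReal (Real.exp 1) *
        μ (AffineMap.homothety p (1 - s) '' (C ∩ {y | L c ≤ L y})) := by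
        rw [Measure.addHaar_image_homothety, abs_of_nonneg (pow_nonneg hs _), mul_left_comm]
    _ ≤ _ := by gcongr

/-- Rounding a real number towards the farther of `0` and `k` gives an integer at a fraction at most
`2 / k` of the way. -/
theorem exists_int_eq_combination {k : ℕ} (hk : 2 ≤ k) (c : ℝ) :
    ∃ s q : ℝ, 0 ≤ s ∧ s ≤ 2 / k ∧ (q = 0 ∨ q = k) ∧ ∃ z : ℤ, (1 - s) * c + s * q = z := by
  have hk' : (2 : ℝ) ≤ k := by exact_mod_cast hk
  rcases le_total c (k / 2) with h | h
  · have hkc : 0 < k - c := by linarith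
    refine ⟨(⌈c⌉ - c) / (k - c), k, div_nonneg (sub_nonneg.2 (Int.le_ceil c)) hkc.le, ?_,
      Or.inr rfl, ⌈c⌉, ?_⟩
    · rw [div_le_div_iff₀ hkc (by linarith)]
      have h1 := Int.ceil_lt_add_one c
      nlinarith
    · field_simp
      ring
  · have hc : 0 < c := by linarith
    refine ⟨(c - ⌊c⌋) / c, 0, div_nonneg (sub_nonneg.2 (Int.floor_le c)) hc.le, ?_,
      Or.inl rfl, ⌊c⌋, ?_⟩
    · rw [div_le_div_iff₀ hc (by linarith)]
      have h1 := Int.lt_floor_add_one c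
      nlinarith
    · field_simp
      ring

/-- The numerical estimate behind the centrepoint bound. Here `ε = d / k`, `v` and `v'` are the
volumes of the body and of its part in a halfspace, `w` and `w'` those of the mixed-integer set and
of its part in the halfspace, `m` bounds the section volumes, `n = d + 1`, and `s` is the fraction
by which the centroid is moved. -/
theorem mul_le_of_halfspace_estimates {ε v v' m w w' s : ℝ} {n : ℕ} (hε : 0 ≤ ε) (hv : 0 ≤ v)
    (hw : 0 ≤ w) (hw' : 0 ≤ w') (hs : s ≤ 1) (hns : n * s ≤ 4 * ε) (hG : (1 - s) ^ n * v ≤ Real.exp 1 * v')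
    (hm : m ≤ 8 * ε * v) (h1 : v' ≤ w' + m) (h2 : w ≤ v + m) :
    (1 / Real.exp 1 - 20 * ε) * w ≤ w' := by
  rcases le_total (1 / Real.exp 1 - 20 * ε) 0 with h | h
  · exact (mul_nonpos_of_nonpos_of_nonneg h hw).trans hw'
  have he : 0 < Real.exp 1 := Real.exp_pos 1
  have he1 : 1 / Real.exp 1 ≤ 1 := by
    rw [div_le_one he]
    exact Real.one_le_exp zero_le_one
  set q := 1 / Real.exp 1 with hq
  have hq0 : 0 < q := by positivity
  have hpow : 1 - 4 * ε ≤ (1 - s) ^ n := by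
    have := one_add_mul_le_pow (a := -s) (by linarith) n
    rw [← sub_eq_add_neg] at this
    linarith
  have hv' : q * ((1 - 4 * ε) * v) ≤ v' := by
    have h3 : (1 - 4 * ε) * v ≤ Real.exp 1 * v' := (mul_le_mul_of_nonneg_right hpow hv).trans hG
    calc q * ((1 - 4 * ε) * v) ≤ q * (Real.exp 1 * v') := by gcongr
      _ = v' := by rw [hq]; field_simp
  have h4 : (q - 20 * ε) * w ≤ (q - 20 * ε) * ((1 + 8 * ε) * v) := by
    gcongr
    linarith
  have h5 : (q - 20 * ε) * ((1 + 8 * ε) * v) ≤ q * ((1 - 4 * ε) * v) - 8 * ε * v := by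
    have h6 : 0 ≤ ε * v * (12 - 12 * q) := by
      have : 0 ≤ 12 - 12 * q := by linarith
      positivity
    have h7 : 0 ≤ 160 * ε * ε * v := by positivity
    nlinarith
  linarith

section Centrepoint

variable {F : Type*} [NormedAddCommGroup F] [NormedSpace ℝ F] [FiniteDimensional ℝ F]
  [MeasurableSpace F] [BorelSpace F] {μ : Measure F} [μ.IsAddHaarMeasure]

theorem lintegral_sectionVolume_intMeasure_ne_top {D : Set (ℝ × F)} (hD : Convex ℝ D)
    (hDc : IsCompact D) (hd : 1 ≤ Module.finrank ℝ F) {k : ℕ} (hk : 1 ≤ k) {p q : ℝ × F}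
    (hp : p ∈ D) (hq : q ∈ D) (hp0 : p.1 = 0) (hqk : q.1 = k) :
    ∫⁻ t, sectionVolume μ D t ∂intMeasure ≠ ⊤ := by
  have hV : ((volume : Measure ℝ).prod μ) D ≠ ⊤ := hDc.measure_lt_top.ne
  have hk' : (0 : ℝ) < k := by exact_mod_cast hk
  refine ne_top_of_le_ne_top ?_ (lintegral_sectionVolume_intMeasure_le_volume_add hD hDc
    (ENNReal.mul_ne_top ENNReal.ofReal_ne_top hV)
    (sectionVolume_le hD hDc hd hk' hp hq hp0 hqk))
  finiteness

theorem lintegral_sectionVolume_intMeasure_ne_zero {D : Set (ℝ × F)} (hD : Convex ℝ D)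
    (hDc : IsCompact D) (hDi : (interior D).Nonempty) (hd : 1 ≤ Module.finrank ℝ F) {k : ℕ}
    (hk : 8 * Module.finrank ℝ F < k) {p q : ℝ × F} (hp : p ∈ D) (hq : q ∈ D) (hp0 : p.1 = 0)
    (hqk : q.1 = k) : ∫⁻ t, sectionVolume μ D t ∂intMeasure ≠ 0 := by
  intro h0
  have hV : ((volume : Measure ℝ).prod μ) D ≠ ⊤ := hDc.measure_lt_top.ne
  have hV0 : ((volume : Measure ℝ).prod μ) D ≠ 0 :=
    (Measure.measure_pos_of_nonempty_interior _ hDi).ne'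
  have hk' : (8 : ℝ) * Module.finrank ℝ F < k := by exact_mod_cast hk
  have hk0 : (0 : ℝ) < k := lt_of_le_of_lt (by positivity) hk'
  have h := volume_le_lintegral_sectionVolume_intMeasure_add hD hDc
    (ENNReal.mul_ne_top ENNReal.ofReal_ne_top hV)
    (sectionVolume_le (μ := μ) hD hDc hd hk0 hp hq hp0 hqk)
  rw [h0, zero_add] at h
  refine (lt_self_iff_false (((volume : Measure ℝ).prod μ) D)).1 (h.trans_lt ?_)
  conv_rhs => rw [← one_mul (((volume : Measure ℝ).prod μ) D)]
  refine ENNReal.mul_lt_mul_left hV0 hV ?_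
  rw [ENNReal.ofReal_lt_one, ← mul_div_assoc, div_lt_one hk0]
  exact hk'

/-- A convex body in `ℝ × F` whose first coordinates include `0` and `k` has a point with integer
first coordinate that is a centrepoint of quality `1/e - O(d / k)`, `d = dim F`, for the union of
the sections over the integers. -/
theorem exists_centrepoint_int {D : Set (ℝ × F)} (hD : Convex ℝ D) (hDc : IsCompact D)
    (hDi : (interior D).Nonempty) (hd : 1 ≤ Module.finrank ℝ F) {k : ℕ} (hk : 2 ≤ k)
    {p q : ℝ × F} (hp : p ∈ D) (hq : q ∈ D) (hp0 : p.1 = 0) (hqk : q.1 = k) :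
    ∃ x ∈ D, (∃ z : ℤ, x.1 = z) ∧ ∀ L : (ℝ × F) →L[ℝ] ℝ,
      ENNReal.ofReal (1 / Real.exp 1 - 20 * (Module.finrank ℝ F / k)) *
          ∫⁻ t, sectionVolume μ D t ∂intMeasure ≤
        ∫⁻ t, sectionVolume μ (D ∩ {y | L x ≤ L y}) t ∂intMeasure := by
  set ν := (volume : Measure ℝ).prod μ
  have hkR : (2 : ℝ) ≤ k := by exact_mod_cast hk
  have hdR : (1 : ℝ) ≤ Module.finrank ℝ F := by exact_mod_cast hd
  obtain ⟨s, r, hs0, hs2, hr, z, hz⟩ := exists_int_eq_combination hk (centroidOf ν D).1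
  obtain ⟨y, hy, hyr⟩ : ∃ y ∈ D, y.1 = r := by
    rcases hr with rfl | rfl
    exacts [⟨p, hp, hp0⟩, ⟨q, hq, hqk⟩]
  have hs1 : s ≤ 1 := hs2.trans ((div_le_one (by linarith)).2 hkR)
  refine ⟨(1 - s) • centroidOf ν D + s • y,
    hD (centroidOf_mem ν hD hDc hDi) hy (sub_nonneg.2 hs1) hs0 (by ring), ⟨z, ?_⟩, fun L => ?_⟩
  · simp [hyr, hz]
  set x := (1 - s) • centroidOf ν D + s • y
  set D' := D ∩ {y | L x ≤ L y}
  have hD' : Convex ℝ D' := hD.inter (convex_halfSpace_ge L.isLinear (L x))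
  have hD'c : IsCompact D' := hDc.inter_right (isClosed_le continuous_const L.continuous)
  have hV : ν D ≠ ⊤ := hDc.measure_lt_top.ne
  have hV' : ν D' ≠ ⊤ := hD'c.measure_lt_top.ne
  have hsec := sectionVolume_le (μ := μ) hD hDc hd (by linarith : (0 : ℝ) < k) hp hq hp0 hqk
  set M := ENNReal.ofReal (8 * (Module.finrank ℝ F / k)) * ν D with hM
  have hMt : M ≠ ⊤ := ENNReal.mul_ne_top ENNReal.ofReal_ne_top hV
  have h2 := lintegral_sectionVolume_intMeasure_le_volume_add hD hDc hMt hsec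
  have hsec' : ∀ t, sectionVolume μ D' t ≤ M := fun t =>
    (sectionVolume_mono inter_subset_left t).trans (hsec t)
  have h1 := volume_le_lintegral_sectionVolume_intMeasure_add hD' hD'c hMt hsec'
  have h3 := lintegral_sectionVolume_intMeasure_le_volume_add hD' hD'c hMt hsec'
  have hG := pow_mul_measure_le_measure_inter_halfspace ν hD hDc hDi L hy hs0 hs1
  set W := ∫⁻ t, sectionVolume μ D t ∂intMeasure
  set W' := ∫⁻ t, sectionVolume μ D' t ∂intMeasure
  have hW : W ≠ ⊤ := ne_top_of_le_ne_top (by finiteness) h2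
  have hW' : W' ≠ ⊤ := ne_top_of_le_ne_top (by finiteness) h3
  rw [← ENNReal.ofReal_toReal hW, ← ENNReal.ofReal_mul' ENNReal.toReal_nonneg]
  refine ENNReal.ofReal_le_of_le_toReal ?_
  refine mul_le_of_halfspace_estimates (v := (ν D).toReal) (v' := (ν D').toReal) (m := M.toReal)
    (n := Module.finrank ℝ (ℝ × F)) (by positivity) ENNReal.toReal_nonneg ENNReal.toReal_nonneg
    ENNReal.toReal_nonneg hs1 ?_ ?_ ?_ ?_ ?_
  · rw [Module.finrank_prod, Module.finrank_self]
    push_cast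
    calc (1 + (Module.finrank ℝ F : ℝ)) * s ≤ (2 * Module.finrank ℝ F) * (2 / k) := by
          gcongr
          linarith
      _ = _ := by ring
  · have := ENNReal.toReal_mono (by finiteness) hG
    rwa [ENNReal.toReal_mul, ENNReal.toReal_mul, ENNReal.toReal_ofReal (Real.exp_pos _).le,
      ENNReal.toReal_ofReal (pow_nonneg (sub_nonneg.2 hs1) _)] at this
  · rw [hM, ENNReal.toReal_mul, ENNReal.toReal_ofReal (by positivity)]
  · have := ENNReal.toReal_mono (by finiteness) h1
    rwa [ENNReal.toReal_add hW' hMt] at this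
  · have := ENNReal.toReal_mono (by finiteness) h2
    rwa [ENNReal.toReal_add hV hMt] at this

end Centrepoint

/-! ### Mixed-integer sets in Euclidean space -/

/-- The identification of `ℝ × ℝᵈ` with `ℝᵈ⁺¹` that makes the real factor coordinate `0`. -/
noncomputable def consCLE (d : ℕ) :
    (ℝ × EuclideanSpace ℝ (Fin d)) ≃L[ℝ] EuclideanSpace ℝ (Fin (d + 1)) :=
  LinearEquiv.toContinuousLinearEquiv
    { toFun := fun p => WithLp.toLp 2 (Fin.cons p.1 p.2.ofLp)
      invFun := fun x => (x 0, WithLp.toLp 2 (Fin.tail x.ofLp))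
      map_add' := fun p q => by
        ext i
        refine Fin.cases ?_ (fun j => ?_) i <;> simp
      map_smul' := fun c p => by
        ext i
        refine Fin.cases ?_ (fun j => ?_) i <;> simp
      left_inv := fun p => by simp
      right_inv := fun x => by simp }

theorem consCLE_apply_zero {d : ℕ} (p : ℝ × EuclideanSpace ℝ (Fin d)) :
    consCLE d p 0 = p.1 := rfl

theorem isometry_consCLE_mk (d : ℕ) (t : ℝ) :
    Isometry fun y : EuclideanSpace ℝ (Fin d) => consCLE d (t, y) := by
  refine Isometry.of_dist_eq fun x y => ?_
  rw [EuclideanSpace.dist_eq, EuclideanSpace.dist_eq, Fin.sum_univ_succ]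
  simp [consCLE]

theorem mixedIntegerPart_inter {d : ℕ} (C H : Set (EuclideanSpace ℝ (Fin (d + 1)))) :
    mixedIntegerPart C ∩ H = mixedIntegerPart (C ∩ H) := by
  ext x
  simp only [mixedIntegerPart, mem_inter_iff, mem_ofPred_eq]
  tauto

theorem mixedIntegerPart_eq_iUnion {d : ℕ} (C : Set (EuclideanSpace ℝ (Fin (d + 1)))) :
    mixedIntegerPart C =
      ⋃ z : ℤ, (fun y => consCLE d (z, y)) '' (Prod.mk (z : ℝ) ⁻¹' (consCLE d ⁻¹' C)) := by
  ext x
  simp only [mixedIntegerPart, mem_ofPred_eq, mem_iUnion, mem_image, mem_preimage]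
  constructor
  · rintro ⟨hx, z, hz⟩
    have h : consCLE d (z, ((consCLE d).symm x).2) = x := by
      rw [← hz]
      exact (consCLE d).apply_symm_apply x
    exact ⟨z, _, h.symm ▸ hx, h⟩
  · rintro ⟨z, y, hy, rfl⟩
    exact ⟨hy, z, rfl⟩

/-- The `d`-dimensional Hausdorff measure of a mixed-integer set is the sum of the measures of its
integer sections. -/
theorem hausdorffMeasure_mixedIntegerPart {d : ℕ} {C : Set (EuclideanSpace ℝ (Fin (d + 1)))}
    (hC : IsCompact C) : Measure.hausdorffMeasure (d : ℝ) (mixedIntegerPart C) =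
      ∫⁻ t, sectionVolume (Measure.hausdorffMeasure (Module.finrank ℝ (EuclideanSpace ℝ (Fin d))))
        (consCLE d ⁻¹' C) t ∂intMeasure := by
  have hD : IsCompact (consCLE d ⁻¹' C) := (consCLE d).toHomeomorph.isCompact_preimage.2 hC
  rw [lintegral_intMeasure (measurable_sectionVolume hD.measurableSet), mixedIntegerPart_eq_iUnion,
    measure_iUnion]
  · refine tsum_congr fun z => ?_
    rw [(isometry_consCLE_mk d z).hausdorffMeasure_image (Or.inl (Nat.cast_nonneg d)),
      finrank_euclideanSpace_fin]
    rfl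
  · intro z z' hzz'
    refine disjoint_left.2 ?_
    rintro _ ⟨y, -, rfl⟩ ⟨y', -, h⟩
    have h0 := congrArg (fun x => x 0) h
    simp only [consCLE_apply_zero, Int.cast_inj] at h0
    exact hzz' h0.symm
  · intro z
    exact ((isometry_consCLE_mk d z).isClosedEmbedding.isClosedMap _
      (hD.isClosed.preimage (by fun_prop))).measurableSet

section Body

variable {d k : ℕ} (hd : 1 ≤ d) {C : Set (EuclideanSpace ℝ (Fin (d + 1)))}
  (hC : Convex ℝ C) (hCc : IsCompact C) (hCi : (interior C).Nonempty)
  (hproj : integerProjection (mixedIntegerPart C) = Icc 0 (k : ℤ))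

theorem exists_mem_preimage_consCLE
    (hproj : integerProjection (mixedIntegerPart C) = Icc 0 (k : ℤ)) {z : ℤ} (hz0 : 0 ≤ z)
    (hzk : z ≤ k) : ∃ p ∈ consCLE d ⁻¹' C, p.1 = z := by
  obtain ⟨x, hx, hxz⟩ : z ∈ integerProjection (mixedIntegerPart C) := hproj ▸ ⟨hz0, hzk⟩
  refine ⟨(consCLE d).symm x, ?_, hxz⟩
  rw [mem_preimage, (consCLE d).apply_symm_apply]
  exact hx.1

include hC hCc hd hproj

theorem hausdorffMeasure_mixedIntegerPart_ne_top (hk : 1 ≤ k) :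
    Measure.hausdorffMeasure (d : ℝ) (mixedIntegerPart C) ≠ ⊤ := by
  obtain ⟨p, hp, hp0⟩ := exists_mem_preimage_consCLE hproj le_rfl (Int.natCast_nonneg k)
  obtain ⟨q, hq, hqk⟩ := exists_mem_preimage_consCLE hproj (Int.natCast_nonneg k) le_rfl
  rw [hausdorffMeasure_mixedIntegerPart hCc]
  exact lintegral_sectionVolume_intMeasure_ne_top (hC.linear_preimage (consCLE d).toLinearMap)
    ((consCLE d).toHomeomorph.isCompact_preimage.2 hCc) (by simpa using hd) hk hp hq
    (by simpa using hp0) (by simpa using hqk)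

include hCi

theorem hausdorffMeasure_mixedIntegerPart_ne_zero (hdk : 8 * d < k) :
    Measure.hausdorffMeasure (d : ℝ) (mixedIntegerPart C) ≠ 0 := by
  obtain ⟨p, hp, hp0⟩ := exists_mem_preimage_consCLE hproj le_rfl (Int.natCast_nonneg k)
  obtain ⟨q, hq, hqk⟩ := exists_mem_preimage_consCLE hproj (Int.natCast_nonneg k) le_rfl
  rw [hausdorffMeasure_mixedIntegerPart hCc]
  refine lintegral_sectionVolume_intMeasure_ne_zero (hC.linear_preimage (consCLE d).toLinearMap)
    ((consCLE d).toHomeomorph.isCompact_preimage.2 hCc) ?_ (by simpa using hd)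
    (by simpa using hdk) hp hq (by simpa using hp0) (by simpa using hqk)
  rw [← ContinuousLinearEquiv.coe_toHomeomorph, ← Homeomorph.preimage_interior]
  exact hCi.preimage (consCLE d).surjective

theorem dimH_mixedIntegerPart (hdk : 8 * d < k) : dimH (mixedIntegerPart C) = d := by
  refine le_antisymm ?_ ?_
  · have h := dimH_le_of_hausdorffMeasure_ne_top (d := (d : NNReal)) (s := mixedIntegerPart C)
      (by simpa using hausdorffMeasure_mixedIntegerPart_ne_top hd hC hCc hproj (by omega))
    simpa using h
  · have h := le_dimH_of_hausdorffMeasure_ne_zero (d := (d : NNReal)) (s := mixedIntegerPart C)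
      (by simpa using hausdorffMeasure_mixedIntegerPart_ne_zero hd hC hCc hCi hproj hdk)
    simpa using h

/-- A mixed-integer convex body has a centrepoint of quality `1/e - O(d / k)` among its points. -/
theorem exists_mixedInteger_centrepoint (hk : 1 ≤ k) : ∃ x ∈ mixedIntegerPart C,
    ∀ H : Set (EuclideanSpace ℝ (Fin (d + 1))), IsHalfspace H → x ∈ H →
      ENNReal.ofReal (1 / Real.exp 1 - 20 * ((d : ℝ) / (k : ℝ))) *
          hausdorffVol (d : ℝ) (mixedIntegerPart C)
        ≤ hausdorffVol (d : ℝ) (mixedIntegerPart C ∩ H) := by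
  obtain ⟨p, hp, hp0⟩ := exists_mem_preimage_consCLE hproj le_rfl (Int.natCast_nonneg k)
  obtain ⟨q, hq, hqk⟩ := exists_mem_preimage_consCLE hproj (Int.natCast_nonneg k) le_rfl
  have hdR : (1 : ℝ) ≤ d := by exact_mod_cast hd
  rcases hk.eq_or_lt with rfl | hk2
  -- For `k = 1` the constant on the left is negative, and any point will do.
  · refine ⟨consCLE d p, ⟨hp, 0, by rw [consCLE_apply_zero, hp0]⟩, fun H _ _ => ?_⟩
    have he1 : 1 / Real.exp 1 ≤ 1 := by
      rw [div_le_one (Real.exp_pos 1)]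
      exact Real.one_le_exp zero_le_one
    rw [ENNReal.ofReal_of_nonpos (by push_cast; linarith), zero_mul]
    exact zero_le
  have hDi : (interior (consCLE d ⁻¹' C)).Nonempty := by
    rw [← ContinuousLinearEquiv.coe_toHomeomorph, ← Homeomorph.preimage_interior]
    exact hCi.preimage (consCLE d).surjective
  obtain ⟨x, hx, ⟨z, hz⟩, hL⟩ := exists_centrepoint_int (D := consCLE d ⁻¹' C)
    (μ := Measure.hausdorffMeasure (Module.finrank ℝ (EuclideanSpace ℝ (Fin d))))
    (hC.linear_preimage (consCLE d).toLinearMap)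
    ((consCLE d).toHomeomorph.isCompact_preimage.2 hCc) hDi (by simpa using hd) hk2 hp hq
    (by simpa using hp0) (by simpa using hqk)
  refine ⟨consCLE d x, ⟨hx, z, hz⟩, ?_⟩
  rintro _ ⟨u, -, b, rfl⟩ hxb
  have hxb' : b ≤ inner ℝ u (consCLE d x) := hxb
  set L : (ℝ × EuclideanSpace ℝ (Fin d)) →L[ℝ] ℝ :=
    (innerSL ℝ u).comp (consCLE d : _ →L[ℝ] EuclideanSpace ℝ (Fin (d + 1)))
  have hclosed : IsClosed {y : EuclideanSpace ℝ (Fin (d + 1)) | inner ℝ u (consCLE d x) ≤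
      inner ℝ u y} := isClosed_le continuous_const (by fun_prop)
  have hpre : consCLE d ⁻¹' (C ∩ {y | inner ℝ u (consCLE d x) ≤ inner ℝ u y}) =
      consCLE d ⁻¹' C ∩ {y | L x ≤ L y} := rfl
  have key := hL L
  rw [← hpre, ← hausdorffMeasure_mixedIntegerPart (hCc.inter_right hclosed),
    ← hausdorffMeasure_mixedIntegerPart hCc, finrank_euclideanSpace_fin,
    ← mixedIntegerPart_inter] at key
  simp only [hausdorffVol, Measure.smul_apply, smul_eq_mul]
  rw [mul_left_comm]
  gcongr
  refine key.trans (measure_mono (inter_subset_inter_right _ fun y hy => ?_))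
  exact hxb'.trans hy

end Body

theorem half_mul_div_add_one_pow_le {d : ℕ} (hd : 1 ≤ d) :
    1 / 2 * ((d : ℝ) / ((d : ℝ) + 1)) ^ d ≤ 1 / 4 := by
  have hd' : (0 : ℝ) < d := by exact_mod_cast hd
  have h1 : (2 : ℝ) ≤ (1 + 1 / d) ^ d := by
    have := one_add_mul_le_pow (a := 1 / (d : ℝ)) (by linarith [one_div_pos.2 hd']) d
    rw [mul_one_div_cancel hd'.ne'] at this
    linarith
  have h2 : ((d : ℝ) / ((d : ℝ) + 1)) ^ d = ((1 + 1 / (d : ℝ)) ^ d)⁻¹ := by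
    rw [← inv_pow]
    congr 1
    field_simp
  have h3 : ((1 + 1 / (d : ℝ)) ^ d)⁻¹ ≤ 2⁻¹ := inv_anti₀ (by norm_num) h1
  rw [h2]
  linarith

theorem mainTheorem3 :
    (∃ A : ℝ, 0 < A ∧
      ∀ (d k : ℕ), 1 ≤ d → 1 ≤ k →
      ∀ C : Set (EuclideanSpace ℝ (Fin (d + 1))),
        Convex ℝ C → IsCompact C → (interior C).Nonempty →
        integerProjection (mixedIntegerPart C) = Set.Icc 0 (k : ℤ) →
        ∃ x ∈ mixedIntegerPart C,
          ∀ H : Set (EuclideanSpace ℝ (Fin (d + 1))), IsHalfspace H → x ∈ H →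
            ENNReal.ofReal (1 / Real.exp 1 - A * ((d : ℝ) / (k : ℝ))) *
                hausdorffVol (d : ℝ) (mixedIntegerPart C)
              ≤ hausdorffVol (d : ℝ) (mixedIntegerPart C ∩ H)) ∧
    (∃ α : ℝ, 0 < α ∧
      ∀ (d k : ℕ), 1 ≤ d → α * (d : ℝ) ≤ (k : ℝ) →
      ∀ C : Set (EuclideanSpace ℝ (Fin (d + 1))),
        Convex ℝ C → IsCompact C → (interior C).Nonempty →
        integerProjection (mixedIntegerPart C) = Set.Icc 0 (k : ℤ) →
        ENNReal.ofReal (1 / 2 * ((d : ℝ) / ((d : ℝ) + 1)) ^ d)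
          ≤ oertelRadius (mixedIntegerPart C)) := by
  refine ⟨⟨20, by norm_num, fun d k hd hk C hC hCc hCi hproj =>
    exists_mixedInteger_centrepoint hd hC hCc hCi hproj hk⟩, ⟨200, by norm_num, ?_⟩⟩
  intro d k hd hdk C hC hCc hCi hproj
  have hd' : (1 : ℝ) ≤ d := by exact_mod_cast hd
  have hk' : (1 : ℝ) ≤ k := by linarith
  have hk : 1 ≤ k := by exact_mod_cast hk'
  have h8 : 8 * d < k := by
    have : (8 : ℝ) * d < k := by linarith
    exact_mod_cast this
  obtain ⟨x, hx, hxH⟩ := exists_mixedInteger_centrepoint hd hC hCc hCi hproj hk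
  have hfactor : ENNReal.ofReal (Real.pi ^ ((d : ℝ) / 2) /
      (Real.Gamma ((d : ℝ) / 2 + 1) * 2 ^ (d : ℝ))) ≠ 0 := by
    have hΓ : 0 < Real.Gamma ((d : ℝ) / 2 + 1) := Real.Gamma_pos_of_pos (by positivity)
    have hπ := Real.pi_pos
    rw [ENNReal.ofReal_ne_zero_iff]
    positivity
  have hvol0 : hausdorffVol (d : ℝ) (mixedIntegerPart C) ≠ 0 := by
    simp only [hausdorffVol, Measure.smul_apply, smul_eq_mul]
    exact mul_ne_zero hfactor
      (hausdorffMeasure_mixedIntegerPart_ne_zero hd hC hCc hCi hproj h8)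
  have hvolt : hausdorffVol (d : ℝ) (mixedIntegerPart C) ≠ ⊤ := by
    simp only [hausdorffVol, Measure.smul_apply, smul_eq_mul]
    exact ENNReal.mul_ne_top ENNReal.ofReal_ne_top
      (hausdorffMeasure_mixedIntegerPart_ne_top hd hC hCc hproj hk)
  -- Since `1 / e > 0.36` and `20 d / k ≤ 1 / 10`, the bound of the first part exceeds `1 / 4`.
  have hconst : 1 / 2 * ((d : ℝ) / ((d : ℝ) + 1)) ^ d ≤
      1 / Real.exp 1 - 20 * ((d : ℝ) / (k : ℝ)) := by
    have h1 := half_mul_div_add_one_pow_le hd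
    have h2 : (d : ℝ) / k ≤ 1 / 200 := by
      rw [div_le_iff₀ (by linarith)]
      linarith
    have h3 : (0.36 : ℝ) ≤ 1 / Real.exp 1 := by
      rw [le_div_iff₀ (Real.exp_pos 1)]
      linarith [Real.exp_one_lt_d9]
    linarith
  rw [oertelRadius, dimH_mixedIntegerPart hd hC hCc hCi hproj h8, ENNReal.toReal_natCast]
  refine le_iSup₂_of_le x hx (le_iInf₂ fun u hu => ?_)
  rw [ENNReal.le_div_iff_mul_le (Or.inl hvol0) (Or.inl hvolt), inter_comm]
  refine le_trans ?_ (hxH (halfspaceAt u x) ⟨u, hu, inner ℝ u x, ?_⟩ ?_)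
  · gcongr
  · ext y
    simp [halfspaceAt, inner_sub_right]
  · simp [halfspaceAt]
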